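/- For $n\in\mathbb Z$ let $J_n$ be the Bessel function of the first kind and let $\mathrm{Ai}$ be the Airy function. For $A>0$ and $s\in\mathbb R$ put $\kappa_A=(A/2)^{1/3}$ and $\nu_A(s)=\lfloor A+s\kappa_A\rfloor$. Let $\hbar,k_B,\Omega,T>0$ and $\mu,E\in\mathbb R$, and put $m_F=\lfloor(\mu-E)/\hbar\Omega\rfloor$, $\eta=(\mu-E)/\hbar\Omega-m_F\in[0,1)$, $E_m=E+m\hbar\Omega$, $f(\varepsilon)=[1+e^{(\varepsilon-\mu)/k_BT}]^{-1}$, and $$K_{A,T}(\nu,\lambda)=\sum_{r\in\mathbb Z}\frac{J_{\nu+r}(A)\,J_{\lambda+r}(A)}{1+e^{-(r+\eta)\hbar\Omega/k_BT}}\qquad(\nu,\lambda\in\mathbb Z).$$ (i) For all $A\in\mathbb R$ and $n,p\in\mathbb Z$, the series $\sum_{m\in\mathbb Z}J_{n-m}(A)J_{p-m}(A)f(E_m)$ (the kernel sum with the sharp Fermi step replaced by the Fermi–Dirac occupation) converges absolutely, with sum $K_{A,T}(n-m_F,p-m_F)$. (ii) Let $\theta>0$, and let $A\to\infty$ with $\theta_A:=k_BT/(\hbar\Omega\kappa_A)=\theta$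 held fixed; here $T,\Omega,\mu,E$ may depend on $A$ in any way compatible with this constraint. Then $$\kappa_A\,K_{A,T}(\nu_A(s),\nu_A(t))\longrightarrow K^{(\theta)}_{\mathrm{Ai}}(s,t):=\int_{-\infty}^{\infty}\frac{\mathrm{Ai}(s+u)\,\mathrm{Ai}(t+u)}{1+e^{-u/\theta}}\,du$$ locally uniformly in $(s,t)\in\mathbb R^2$, the integral being absolutely convergent. (iii) As $\theta\to0^+$, $K^{(\theta)}_{\mathrm{Ai}}(s,t)\to K_{\mathrm{Ai}}(s,t):=\int_0^\infty\mathrm{Ai}(s+u)\,\mathrm{Ai}(t+u)\,du$ locally uniformly in $(s,t)\in\mathbb R^2$, the integral being absolutely convergent. -/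

import Mathlib

open Filter Topology MeasureTheory

/-- The Bessel function of the first kind `J_n(x)` of integer order `n`, by Bessel's integral
`(1/π) ∫_0^π cos (n τ - x sin τ) dτ` (the `n`-th Fourier coefficient of `e^{i x sin τ}`). -/
noncomputable def besselJ (n : ℤ) (x : ℝ) : ℝ :=
  (1 / Real.pi) * ∫ τ in (0 : ℝ)..Real.pi, Real.cos (n * τ - x * Real.sin τ)

/-- The Airy function `Ai`, by its absolutely convergent contour integral
`Ai(x) = (1/2π) ∫ exp (i z³/3 + i x z) dz` over the line `Im z = 1` (`z = v + i`, `v ∈ ℝ`; by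
Cauchy's theorem any line `Im z = c` with `c > 0` gives the same value). The integral is real,
since `v ↦ -v` conjugates the integrand. -/
noncomputable def airyAi (x : ℝ) : ℝ :=
  ((1 / (2 * Real.pi) : ℂ) *
    ∫ v : ℝ, Complex.exp (Complex.I * ((v : ℂ) + Complex.I) ^ 3 / 3
      + Complex.I * x * ((v : ℂ) + Complex.I))).re

/-- The Airy kernel `K_Ai(s,t) = ∫_0^∞ Ai(s+u) Ai(t+u) du`. -/
noncomputable def airyKernel (s t : ℝ) : ℝ :=
  ∫ u in Set.Ioi (0 : ℝ), airyAi (s + u) * airyAi (t + u)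

/-- The finite-temperature Airy kernel
`K_Ai^θ(s,t) = ∫_ℝ Ai(s+u) Ai(t+u) / (1 + e^{-u/θ}) du`. -/
noncomputable def airyKernelThermal (θ s t : ℝ) : ℝ :=
  ∫ u : ℝ, airyAi (s + u) * airyAi (t + u) / (1 + Real.exp (-u / θ))

/-- The edge scale `κ_A = (A/2)^{1/3}`. -/
noncomputable def edgeScale (A : ℝ) : ℝ := (A / 2) ^ (1 / 3 : ℝ)

/-- The edge index `ν_A(s) = ⌊A + s κ_A⌋`. -/
noncomputable def edgeIndex (A s : ℝ) : ℤ := ⌊A + s * edgeScale A⌋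

/-- The Fermi cutoff `m_F(E) = ⌊(μ - E)/ħΩ⌋`. -/
noncomputable def fermiCutoff (hbar Ω μ E : ℝ) : ℤ := ⌊(μ - E) / (hbar * Ω)⌋

/-- The offset `η(E) = (μ - E)/ħΩ - m_F(E) ∈ [0,1)`. -/
noncomputable def fermiOffset (hbar Ω μ E : ℝ) : ℝ :=
  (μ - E) / (hbar * Ω) - fermiCutoff hbar Ω μ E

/-- The Fermi-Dirac occupation `[1 + exp((ε - μ)/k_B T)]⁻¹` at energy `ε`. -/
noncomputable def fermiDirac (kB T μ ε : ℝ) : ℝ :=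
  1 / (1 + Real.exp ((ε - μ) / (kB * T)))

/-- The thermal kernel
`K_{A,T}(ν,l) = ∑_{r ∈ ℤ} J_{ν+r}(A) J_{l+r}(A) / (1 + e^{-(r+η) ħΩ/k_B T})`. -/
noncomputable def thermalKernel (hbar kB Ω μ E A T : ℝ) (ν l : ℤ) : ℝ :=
  ∑' r : ℤ, besselJ (ν + r) A * besselJ (l + r) A *
    (1 / (1 + Real.exp (-((r + fermiOffset hbar Ω μ E) * (hbar * Ω) / (kB * T)))))

/-- The crossover parameter `θ_A = k_B T / (ħ Ω κ_A)`. -/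
noncomputable def crossoverParameter (hbar kB Ω T A : ℝ) : ℝ :=
  kB * T / (hbar * Ω * edgeScale A)

/-! Write `A = 2κ³`. Bessel's integrand is entire and `2π`-periodic, so its contour may be moved to
`Im z = c/κ`. After rescaling by `κ`, the phase tends to the Airy phase and the integrand has a
Gaussian majorant. This gives both `κ J_n(2κ³) → Ai(x)` when `(n - 2κ³)/κ → x`
(`tendsto_edge_besselJ`) and, for every `c > 0` and `κ ≥ c`, a bound of order `exp(-c(n - 2κ³)/κ)`
(`abs_edge_besselJ_le`).

That bound grows on the oscillatory side, but there the Fermi weight decays like `exp(u/θ)`. With `c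
= 1/(4θ)` two Bessel factors cost only `exp(-u/(2θ))`, so the product is at most a constant times
`exp(-|u|/(2θ))` and no oscillatory estimate is needed. The sum over `r` is the integral of a step
function of `u ≈ r/κ`, and dominated convergence gives the edge limit; the same domination, uniform
in small `θ`, gives the limit `θ → 0⁺`.

Local uniformity comes from letting `(s,t)` move together with the main parameter in each limit. -/

/-! ### Bessel's integral on shifted lines. -/

/-- The integrand `exp (i (n z - x sin z))` of Bessel's integral, as an entire function of `z`. -/
noncomputable def besselPhase (n : ℤ) (x : ℝ) (z : ℂ) : ℂ :=
  Complex.exp (Complex.I * (n * z - x * Complex.sin z))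

lemma differentiable_besselPhase (n : ℤ) (x : ℝ) : Differentiable ℂ (besselPhase n x) := by
  unfold besselPhase
  fun_prop

lemma continuous_besselPhase (n : ℤ) (x : ℝ) : Continuous (besselPhase n x) :=
  (differentiable_besselPhase n x).continuous

lemma besselPhase_add_two_pi (n : ℤ) (x : ℝ) (z : ℂ) :
    besselPhase n x (z + 2 * Real.pi) = besselPhase n x z := by
  unfold besselPhase
  rw [Complex.sin_add_two_pi, Complex.exp_eq_exp_iff_exists_int]
  exact ⟨n, by ring⟩

lemma norm_besselPhase (n : ℤ) (x τ δ : ℝ) :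
    ‖besselPhase n x (τ + δ * Complex.I)‖ =
      Real.exp (-(n * δ) + x * (Real.sinh δ * Real.cos τ)) := by
  unfold besselPhase
  rw [Complex.norm_exp, Complex.sin_add_mul_I]
  congr 1
  have h1 : Complex.I * (n * (τ + δ * Complex.I) - x * (Complex.sin τ * Complex.cosh δ +
      Complex.cos τ * Complex.sinh δ * Complex.I)) =
      ((-(n * δ) + x * (Real.sinh δ * Real.cos τ) : ℝ) : ℂ) +
      ((n * τ - x * (Real.sin τ * Real.cosh δ) : ℝ) : ℂ) * Complex.I := by
    push_cast
    ring_nf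
    simp only [Complex.I_sq]
    ring
  rw [h1, Complex.add_re, Complex.re_ofReal_mul, Complex.ofReal_re, Complex.I_re]
  ring

lemma integral_besselPhase_real (n : ℤ) (x : ℝ) :
    ∫ τ in (-Real.pi)..Real.pi, besselPhase n x τ = ((2 * Real.pi * besselJ n x : ℝ) : ℂ) := by
  have hc : Continuous fun τ : ℝ => besselPhase n x τ :=
    (continuous_besselPhase n x).comp Complex.continuous_ofReal
  have h0 : ∫ τ in (-Real.pi)..0, besselPhase n x τ =
      ∫ τ in (0 : ℝ)..Real.pi, besselPhase n x ((-τ : ℝ) : ℂ) := by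
    rw [intervalIntegral.integral_comp_neg (fun τ : ℝ => besselPhase n x τ)]
    simp
  have hc' : Continuous fun τ : ℝ => besselPhase n x ((-τ : ℝ) : ℂ) := hc.comp continuous_neg
  rw [← intervalIntegral.integral_add_adjacent_intervals (hc.intervalIntegrable _ 0)
    (hc.intervalIntegrable _ _), h0, ← intervalIntegral.integral_add
    (hc'.intervalIntegrable _ _) (hc.intervalIntegrable _ _)]
  have h2 : ∀ τ : ℝ, besselPhase n x ((-τ : ℝ) : ℂ) + besselPhase n x τ =
      ((2 * Real.cos (n * τ - x * Real.sin τ) : ℝ) : ℂ) := by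
    intro τ
    unfold besselPhase
    push_cast
    rw [Complex.two_cos, Complex.sin_neg, add_comm]
    congr 2 <;> ring
  simp_rw [h2]
  rw [intervalIntegral.integral_ofReal, intervalIntegral.integral_const_mul, besselJ]
  congr 1
  field_simp

/-- Bessel's integral over the shifted segment `Im z = δ`. -/
lemma integral_besselPhase_shift (n : ℤ) (x δ : ℝ) :
    ∫ τ in (-Real.pi)..Real.pi, besselPhase n x (τ + δ * Complex.I) =
      ((2 * Real.pi * besselJ n x : ℝ) : ℂ) := by
  have h := Complex.integral_boundary_rect_eq_zero_of_differentiableOn (besselPhase n x)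
    ((-Real.pi : ℝ) : ℂ) ((Real.pi : ℂ) + δ * Complex.I)
    (differentiable_besselPhase n x).differentiableOn
  -- By periodicity the vertical sides of the rectangle cancel in Cauchy's theorem.
  have hp : ∀ y : ℝ, besselPhase n x ((Real.pi : ℂ) + y * Complex.I) =
      besselPhase n x (((-Real.pi : ℝ) : ℂ) + y * Complex.I) := by
    intro y
    rw [← besselPhase_add_two_pi n x (((-Real.pi : ℝ) : ℂ) + y * Complex.I)]
    congr 1
    push_cast
    ring
  simp only [Complex.ofReal_re, Complex.ofReal_im, Complex.add_re, Complex.add_im,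
    Complex.mul_re, Complex.mul_im, Complex.I_re, Complex.I_im, mul_zero, mul_one, sub_zero,
    add_zero, zero_add, Complex.ofReal_zero, zero_mul] at h
  simp_rw [hp] at h
  rw [← integral_besselPhase_real n x]
  rw [add_sub_cancel_right, sub_eq_zero] at h
  exact h.symm

/-- The sign of `δ` is free: `δ = ±1` gives decay as the order tends to `±∞`, and `δ = 0` gives the
bound 1. -/
lemma abs_besselJ_le (n : ℤ) (x δ : ℝ) :
    |besselJ n x| ≤ Real.exp (-(n * δ)) * Real.exp (|x| * |Real.sinh δ|) := by
  have hpi := Real.pi_pos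
  have h := intervalIntegral.norm_integral_le_of_norm_le_const (a := -Real.pi) (b := Real.pi)
    (f := fun τ : ℝ => besselPhase n x (τ + δ * Complex.I))
    (C := Real.exp (-(n * δ)) * Real.exp (|x| * |Real.sinh δ|)) (by
      intro τ _
      rw [norm_besselPhase, ← Real.exp_add, Real.exp_le_exp]
      refine add_le_add_right ?_ _
      calc x * (Real.sinh δ * Real.cos τ) ≤ |x * (Real.sinh δ * Real.cos τ)| := le_abs_self _
        _ = |x| * (|Real.sinh δ| * |Real.cos τ|) := by rw [abs_mul, abs_mul]
        _ ≤ |x| * (|Real.sinh δ| * 1) := by gcongr; exact Real.abs_cos_le_one τ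
        _ = _ := by ring)
  rw [integral_besselPhase_shift, Complex.norm_real, Real.norm_eq_abs, abs_mul,
    abs_of_pos (by positivity : (0 : ℝ) < 2 * Real.pi), sub_neg_eq_add, ← two_mul,
    abs_of_pos (by positivity : (0 : ℝ) < 2 * Real.pi), mul_comm] at h
  exact le_of_mul_le_mul_right h (by positivity)

lemma summable_besselJ (x : ℝ) : Summable fun n : ℤ => |besselJ n x| := by
  have hs : Summable fun k : ℕ => Real.exp (-(k : ℝ)) * Real.exp (|x| * |Real.sinh 1|) :=
    Real.summable_exp_neg_nat.mul_right _
  refine Summable.of_nat_of_neg ?_ ?_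
  · refine hs.of_nonneg_of_le (fun _ => abs_nonneg _) fun k => ?_
    simpa using abs_besselJ_le k x 1
  · refine hs.of_nonneg_of_le (fun _ => abs_nonneg _) fun k => ?_
    simpa using abs_besselJ_le (-k) x (-1)

/-! ### Convergence of the Fermi-Dirac kernel sum. -/

lemma summable_besselJ_mul_besselJ_mul (x : ℝ) (ν l : ℤ) {w : ℤ → ℝ} (hw : ∀ r, |w r| ≤ 1) :
    Summable fun r : ℤ => besselJ (ν + r) x * besselJ (l + r) x * w r := by
  -- The exponential factor equals 1; it is the bound from `abs_besselJ_le` at `δ = 0`.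
  have h1 : Summable fun r : ℤ => |besselJ (ν + r) x| * Real.exp (|x| * |Real.sinh 0|) :=
    ((Equiv.addLeft ν).summable_iff.mpr (summable_besselJ x)).mul_right _
  refine Summable.of_norm_bounded h1 fun r => ?_
  rw [norm_mul, norm_mul, Real.norm_eq_abs, Real.norm_eq_abs, Real.norm_eq_abs, mul_assoc]
  gcongr
  have := abs_besselJ_le (l + r) x 0
  rw [mul_zero, neg_zero, Real.exp_zero, one_mul] at this
  calc |besselJ (l + r) x| * |w r| ≤ |besselJ (l + r) x| * 1 := by gcongr; exact hw r
    _ ≤ _ := by rw [mul_one]; exact this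

lemma abs_one_div_one_add_exp_le_one (x : ℝ) : |1 / (1 + Real.exp x)| ≤ 1 := by
  have := Real.exp_pos x
  rw [abs_of_pos (by positivity), div_le_one (by positivity)]
  linarith

lemma hasSum_fermiDirac {hbar kB Ω T : ℝ} (hhbar : hbar ≠ 0) (hΩ : Ω ≠ 0) (μ E A : ℝ) (n p : ℤ) :
    HasSum
      (fun m : ℤ => besselJ (n - m) A * besselJ (p - m) A * fermiDirac kB T μ (E + m * (hbar * Ω)))
      (thermalKernel hbar kB Ω μ E A T
        (n - fermiCutoff hbar Ω μ E) (p - fermiCutoff hbar Ω μ E)) := by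
  have hs := (summable_besselJ_mul_besselJ_mul A (n - fermiCutoff hbar Ω μ E)
    (p - fermiCutoff hbar Ω μ E) (w := fun r : ℤ => 1 / (1 + Real.exp
      (-((r + fermiOffset hbar Ω μ E) * (hbar * Ω) / (kB * T)))))
    fun r => abs_one_div_one_add_exp_le_one _).hasSum
  -- Substituting `r = m_F - m` gives `(r + η)ħΩ = μ - E_m`.
  rw [← (Equiv.subLeft (fermiCutoff hbar Ω μ E)).hasSum_iff] at hs
  unfold thermalKernel
  convert hs using 1
  ext m
  simp only [Function.comp, Equiv.subLeft_apply, fermiDirac]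
  have h1 : ∀ k : ℤ, k - fermiCutoff hbar Ω μ E + (fermiCutoff hbar Ω μ E - m) = k - m :=
    fun k => by ring
  rw [h1, h1]
  congr 4
  unfold fermiOffset
  push_cast
  rw [← neg_div]
  congr 1
  field_simp
  ring

/-! ### Bessel functions at the turning point. -/

/-- `2/9` is the cubic remainder constant for `exp`, averaged over `±δ`; the sharp value is not
needed. -/
lemma sinh_sub_self_le {δ : ℝ} (h0 : 0 ≤ δ) (h1 : δ ≤ 1) : Real.sinh δ - δ ≤ 2 / 9 * δ ^ 3 := by
  have h := Real.exp_bound (x := δ) (by rwa [abs_of_nonneg h0]) (n := 3) (by norm_num)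
  have h' := Real.exp_bound (x := -δ) (by rwa [abs_neg, abs_of_nonneg h0]) (n := 3) (by norm_num)
  rw [abs_neg] at h'
  rw [abs_of_nonneg h0] at h h'
  simp only [Finset.sum_range_succ, Finset.sum_range_zero] at h h'
  norm_num [Nat.factorial] at h h'
  rw [abs_le] at h h'
  rw [Real.sinh_eq]
  linarith [h.2, h'.1]

/-- The prefactor in the uniform exponential bound for `κ J_n(2κ³)`. -/
noncomputable def edgeConst (c : ℝ) : ℝ :=
  Real.exp (4 / 9 * c ^ 3) * ∫ v : ℝ, Real.exp (-(4 * c / Real.pi ^ 2) * v ^ 2)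

/-- The rescaled integrand of `κ J_n(2κ³)` on the line `Im z = c`, extended by zero. -/
noncomputable def edgePhase (n : ℤ) (κ c : ℝ) : ℝ → ℂ :=
  (Set.Ioc (-(κ * Real.pi)) (κ * Real.pi)).indicator fun v =>
    besselPhase n (2 * κ ^ 3) (((v / κ : ℝ) : ℂ) + ((c / κ : ℝ) : ℂ) * Complex.I)

lemma integral_edgePhase (n : ℤ) {κ : ℝ} (hκ : 0 < κ) (c : ℝ) :
    ∫ v, edgePhase n κ c v = ((2 * Real.pi * (κ * besselJ n (2 * κ ^ 3)) : ℝ) : ℂ) := by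
  have hpi := Real.pi_pos
  unfold edgePhase
  rw [integral_indicator measurableSet_Ioc, ← intervalIntegral.integral_of_le (by nlinarith),
    intervalIntegral.integral_comp_div
      (fun τ : ℝ => besselPhase n (2 * κ ^ 3) ((τ : ℂ) + ((c / κ : ℝ) : ℂ) * Complex.I)) hκ.ne']
  have h1 : -(κ * Real.pi) / κ = -Real.pi := by field_simp
  have h2 : κ * Real.pi / κ = Real.pi := by field_simp
  rw [h1, h2, integral_besselPhase_shift, Complex.real_smul, ← Complex.ofReal_mul]
  congr 1
  ring

lemma aestronglyMeasurable_edgePhase (n : ℤ) (κ c : ℝ) :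
    AEStronglyMeasurable (edgePhase n κ c) := by
  refine AEStronglyMeasurable.indicator (Continuous.aestronglyMeasurable ?_) measurableSet_Ioc
  exact (continuous_besselPhase _ _).comp (by fun_prop)

/-- On `|τ| ≤ π`, `cos τ ≤ 1 - 2τ²/π²`. The upper bound on `sinh` is used for the constant term and
`sinh δ ≥ δ` for the quadratic one; multiplying by `2κ³` produces `4/9 c³` and `4c/π²`. -/
lemma norm_edgePhase_le (n : ℤ) {κ c : ℝ} (hc : 0 < c) (hcκ : c ≤ κ) (v : ℝ) :
    ‖edgePhase n κ c v‖ ≤ Real.exp (-(c * ((n - 2 * κ ^ 3) / κ))) *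
      (Real.exp (4 / 9 * c ^ 3) * Real.exp (-(4 * c / Real.pi ^ 2) * v ^ 2)) := by
  have hpi := Real.pi_pos
  have hκ : 0 < κ := hc.trans_le hcκ
  unfold edgePhase
  by_cases hv : v ∈ Set.Ioc (-(κ * Real.pi)) (κ * Real.pi)
  swap
  · rw [Set.indicator_of_notMem hv, norm_zero]
    positivity
  rw [Set.indicator_of_mem hv, norm_besselPhase, ← Real.exp_add, ← Real.exp_add, Real.exp_le_exp]
  have hcos : Real.cos (v / κ) ≤ 1 - 2 / Real.pi ^ 2 * (v / κ) ^ 2 := by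
    refine Real.cos_le_one_sub_mul_cos_sq ?_
    rw [abs_div, abs_of_pos hκ, div_le_iff₀ hκ, abs_le]
    constructor <;> nlinarith [hv.1, hv.2]
  have hδ0 : 0 < c / κ := by positivity
  have hδ1 : c / κ ≤ 1 := (div_le_one hκ).mpr hcκ
  have hs := sinh_sub_self_le hδ0.le hδ1
  have hs' : c / κ ≤ Real.sinh (c / κ) := Real.self_le_sinh_iff.mpr hδ0.le
  have h1 : Real.sinh (c / κ) * Real.cos (v / κ) ≤
      c / κ + 2 / 9 * (c / κ) ^ 3 - c / κ * (2 / Real.pi ^ 2 * (v / κ) ^ 2) := by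
    have h2 : Real.sinh (c / κ) * Real.cos (v / κ) ≤
        Real.sinh (c / κ) * (1 - 2 / Real.pi ^ 2 * (v / κ) ^ 2) := by
      gcongr
    have h3 : c / κ * (2 / Real.pi ^ 2 * (v / κ) ^ 2) ≤
        Real.sinh (c / κ) * (2 / Real.pi ^ 2 * (v / κ) ^ 2) := by gcongr
    linarith
  calc _ ≤ -(n * (c / κ)) + 2 * κ ^ 3 *
      (c / κ + 2 / 9 * (c / κ) ^ 3 - c / κ * (2 / Real.pi ^ 2 * (v / κ) ^ 2)) := by gcongr
    _ = _ := by
      field_simp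
      ring

lemma integrable_exp_edge {c : ℝ} (hc : 0 < c) :
    Integrable fun v : ℝ => Real.exp (-(4 * c / Real.pi ^ 2) * v ^ 2) :=
  integrable_exp_neg_mul_sq (by have := Real.pi_pos; positivity)

lemma edgeConst_nonneg (c : ℝ) : 0 ≤ edgeConst c :=
  mul_nonneg (Real.exp_pos _).le (integral_nonneg fun _ => (Real.exp_pos _).le)

/-- Uniform exponential bound for Bessel functions at the turning point. -/
lemma abs_edge_besselJ_le (n : ℤ) {κ c : ℝ} (hc : 0 < c) (hcκ : c ≤ κ) :
    |κ * besselJ n (2 * κ ^ 3)| ≤ edgeConst c * Real.exp (-(c * ((n - 2 * κ ^ 3) / κ))) := by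
  have h := norm_integral_le_of_norm_le (((integrable_exp_edge hc).const_mul _).const_mul _)
    (Eventually.of_forall (norm_edgePhase_le n hc hcκ))
  rw [integral_edgePhase n (hc.trans_le hcκ), integral_const_mul, integral_const_mul,
    Complex.norm_real, Real.norm_eq_abs, abs_mul,
    abs_of_pos (by have := Real.pi_pos; positivity : (0 : ℝ) < 2 * Real.pi)] at h
  rw [mul_comm (edgeConst c)]
  unfold edgeConst
  refine le_trans ?_ h
  have := Real.pi_gt_three
  exact le_mul_of_one_le_left (abs_nonneg _) (by linarith)

/-- Only the cubic Taylor term survives: the fifth-order remainder contributes `O(κ⁻²)`. -/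
lemma tendsto_mul_sub_sin (z : ℂ) :
    Tendsto (fun κ : ℝ => ((2 * κ ^ 3 : ℝ) : ℂ) * (z / κ - Complex.sin (z / κ))) atTop
      (𝓝 (z ^ 3 / 3)) := by
  rw [tendsto_iff_norm_sub_tendsto_zero]
  have hlim : Tendsto (fun κ : ℝ => 2 * ‖z‖ ^ 5 * (1 / 100) * (κ ^ 2)⁻¹) atTop (𝓝 0) := by
    simpa using ((tendsto_pow_atTop (α := ℝ) two_ne_zero).inv_tendsto_atTop).const_mul (2 * ‖z‖ ^ 5 * (1 / 100))
  refine squeeze_zero' (Eventually.of_forall fun _ => norm_nonneg _) ?_ hlim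
  filter_upwards [eventually_ge_atTop ‖z‖, eventually_gt_atTop 0] with κ hκz hκ
  have hn : ‖z / (κ : ℂ)‖ = ‖z‖ / κ := by
    rw [norm_div, Complex.norm_real, Real.norm_eq_abs, abs_of_pos hκ]
  have hb := Complex.sin_bound (x := z / κ) (by rw [hn]; exact (div_le_one hκ).mpr hκz)
  have hκ' : (κ : ℂ) ≠ 0 := by exact_mod_cast hκ.ne'
  have he : ((2 * κ ^ 3 : ℝ) : ℂ) * (z / κ - Complex.sin (z / κ)) - z ^ 3 / 3 =
      -(((2 * κ ^ 3 : ℝ) : ℂ) * (Complex.sin (z / κ) - (z / κ - (z / κ) ^ 3 / 6))) := by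
    push_cast
    field_simp
    ring
  rw [he, norm_neg, norm_mul, Complex.norm_real, Real.norm_eq_abs,
    abs_of_pos (by positivity : 0 < 2 * κ ^ 3)]
  rw [hn] at hb
  calc _ ≤ 2 * κ ^ 3 * ((‖z‖ / κ) ^ 5 / 100) := by gcongr
    _ = _ := by field_simp

/-- The transition-region asymptotics of Bessel functions. -/
lemma tendsto_edge_besselJ {ι : Type*} {l : Filter ι} [l.IsCountablyGenerated]
    {n : ι → ℤ} {κ : ι → ℝ} {x : ℝ} (hκ : Tendsto κ l atTop)
    (hn : Tendsto (fun i => (n i - 2 * κ i ^ 3) / κ i) l (𝓝 x)) :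
    Tendsto (fun i => κ i * besselJ (n i) (2 * κ i ^ 3)) l (𝓝 (airyAi x)) := by
  have hpi := Real.pi_pos
  have key : Tendsto (fun i => ∫ v, edgePhase (n i) (κ i) 1 v) l
      (𝓝 (∫ v : ℝ, Complex.exp (Complex.I * ((v : ℂ) + Complex.I) ^ 3 / 3
        + Complex.I * x * ((v : ℂ) + Complex.I)))) := by
    refine tendsto_integral_filter_of_dominated_convergence
      -- The height is `c = 1`, as in the definition of `airyAi`; the prefactor uses that eventually
      -- `(n - 2κ³)/κ > x - 1`.
      (fun v : ℝ => Real.exp (-x + 1) * (Real.exp (4 / 9 * 1 ^ 3) *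
        Real.exp (-(4 * 1 / Real.pi ^ 2) * v ^ 2)))
      (Eventually.of_forall fun i => aestronglyMeasurable_edgePhase _ _ _) ?_
      (((integrable_exp_edge one_pos).const_mul _).const_mul _) ?_
    · filter_upwards [hκ.eventually_ge_atTop 1, hn.eventually (lt_mem_nhds (sub_one_lt x))]
        with i h1 h2
      refine Eventually.of_forall fun v => (norm_edgePhase_le _ one_pos h1 v).trans ?_
      gcongr
      linarith
    · refine Eventually.of_forall fun v => ?_
      have hlim : Tendsto (fun i => Complex.exp (Complex.I *
          ((((n i - 2 * κ i ^ 3) / κ i : ℝ) : ℂ) * (v + Complex.I) +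
          ((2 * κ i ^ 3 : ℝ) : ℂ) * ((v + Complex.I) / κ i - Complex.sin ((v + Complex.I) / κ i)))))
          l (𝓝 (Complex.exp (Complex.I * ((v : ℂ) + Complex.I) ^ 3 / 3
        + Complex.I * x * ((v : ℂ) + Complex.I)))) := by
        have h1 := (((Complex.continuous_ofReal.tendsto x).comp hn).mul_const
          (v + Complex.I)).add ((tendsto_mul_sub_sin (v + Complex.I)).comp hκ)
        have h2 := (Complex.continuous_exp.tendsto _).comp (h1.const_mul Complex.I)
        have h3 : Complex.I * (x * (v + Complex.I) + (v + Complex.I) ^ 3 / 3) =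
            Complex.I * ((v : ℂ) + Complex.I) ^ 3 / 3 + Complex.I * x * ((v : ℂ) + Complex.I) := by
          ring
        rw [← h3]
        exact h2
      refine hlim.congr' ?_
      filter_upwards [hκ.eventually_gt_atTop 0, hκ.eventually_gt_atTop (|v| / Real.pi)]
        with i h0 h1
      rw [div_lt_iff₀ hpi, abs_lt] at h1
      rw [edgePhase, Set.indicator_of_mem (Set.mem_Ioc.mpr ⟨h1.1, h1.2.le⟩), besselPhase]
      have h0' : (κ i : ℂ) ≠ 0 := by exact_mod_cast h0.ne'
      have hz : (((v / κ i : ℝ) : ℂ) + ((1 / κ i : ℝ) : ℂ) * Complex.I) =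
          (v + Complex.I) / κ i := by
        push_cast
        ring
      rw [hz]
      congr 2
      push_cast
      field_simp
      ring
  have key2 : Tendsto (fun i => ((1 / (2 * Real.pi) : ℂ) *
      ∫ v, edgePhase (n i) (κ i) 1 v).re) l (𝓝 (airyAi x)) :=
    (Complex.continuous_re.tendsto _).comp (key.const_mul _)
  refine key2.congr' ?_
  filter_upwards [hκ.eventually_gt_atTop 0] with i h0
  rw [integral_edgePhase _ h0]
  have : (1 / (2 * Real.pi) : ℂ) * ((2 * Real.pi * (κ i * besselJ (n i) (2 * κ i ^ 3)) : ℝ) : ℂ) =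
      ((κ i * besselJ (n i) (2 * κ i ^ 3) : ℝ) : ℂ) := by
    push_cast
    have : (Real.pi : ℂ) ≠ 0 := by exact_mod_cast hpi.ne'
    field_simp
  rw [this, Complex.ofReal_re]

/-! ### Joint limits and local uniformity. -/

/-- For `y` near `x`, the values `F a y` lie eventually within `ε/2` of `G x`; letting `a` run along
`p` transfers this to `G y`. -/
lemma continuous_of_tendsto_prod {ι X : Type*} [TopologicalSpace X] {p : Filter ι} [p.NeBot]
    {F : ι → X → ℝ} {G : X → ℝ}
    (h : ∀ x, Tendsto (fun y : ι × X => F y.1 y.2) (p ×ˢ 𝓝 x) (𝓝 (G x))) : Continuous G := by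
  refine continuous_iff_continuousAt.mpr fun x => Metric.tendsto_nhds.mpr fun ε hε => ?_
  obtain ⟨P, hP, Q, hQ, hPQ⟩ := eventually_prod_iff.mp
    (Metric.tendsto_nhds.mp (h x) (ε / 2) (half_pos hε))
  filter_upwards [hQ] with y hy
  have h1 : Tendsto (fun a => F a y) p (𝓝 (G y)) :=
    (h y).comp (tendsto_id.prodMk tendsto_const_nhds)
  refine lt_of_le_of_lt ?_ (half_lt_self hε)
  refine le_of_tendsto (h1.dist tendsto_const_nhds) ?_
  filter_upwards [hP] with a ha using (hPQ ha hy).le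

lemma tendstoLocallyUniformly_of_tendsto_prod {ι X : Type*} [TopologicalSpace X] {p : Filter ι}
    [p.NeBot] {F : ι → X → ℝ} {G : X → ℝ}
    (h : ∀ x, Tendsto (fun y : ι × X => F y.1 y.2) (p ×ˢ 𝓝 x) (𝓝 (G x))) :
    TendstoLocallyUniformly F G p := by
  rw [tendstoLocallyUniformly_iff_forall_tendsto]
  intro x
  have hG : Tendsto (fun y : ι × X => G y.2) (p ×ˢ 𝓝 x) (𝓝 (G x)) :=
    ((continuous_of_tendsto_prod h).tendsto x).comp tendsto_snd
  exact Filter.Tendsto.mono_right (hG.prodMk_nhds (h x)) (nhds_le_uniformity (G x))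

/-! ### The Airy function as a limit of Bessel functions. -/

/-- The tolerance 2 leaves room for two floors, one in the edge index and one in the summation
variable. -/
lemma tendsto_edge_index {ι : Type*} {l : Filter ι} {n : ι → ℤ} {κ x : ι → ℝ} {x₀ : ℝ}
    (hκ : Tendsto κ l atTop) (hx : Tendsto x l (𝓝 x₀))
    (hn : ∀ i, |n i - (2 * κ i ^ 3 + x i * κ i)| ≤ 2) :
    Tendsto (fun i => (n i - 2 * κ i ^ 3) / κ i) l (𝓝 x₀) := by
  have h0 : Tendsto (fun i => 2 / κ i) l (𝓝 0) := hκ.const_div_atTop 2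
  have h1 : Tendsto (fun i => (n i - (2 * κ i ^ 3 + x i * κ i)) / κ i) l (𝓝 0) := by
    refine squeeze_zero_norm' ?_ h0
    filter_upwards [hκ.eventually_gt_atTop 0] with i hi
    rw [norm_div, Real.norm_eq_abs, Real.norm_eq_abs, abs_of_pos hi]
    gcongr
    exact hn i
  have h2 := h1.add hx
  rw [zero_add] at h2
  refine h2.congr' ?_
  filter_upwards [hκ.eventually_gt_atTop 0] with i hi
  field_simp
  ring

lemma abs_floor_sub_le (y : ℝ) : |⌊y⌋ - y| ≤ 1 := by
  rw [abs_le]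
  constructor <;> linarith [Int.floor_le y, Int.lt_floor_add_one y]

lemma tendsto_edge_airyAi (x : ℝ) :
    Tendsto (fun y : ℝ × ℝ => y.1 * besselJ ⌊2 * y.1 ^ 3 + y.2 * y.1⌋ (2 * y.1 ^ 3))
      (atTop ×ˢ 𝓝 x) (𝓝 (airyAi x)) :=
  tendsto_edge_besselJ tendsto_fst (tendsto_edge_index tendsto_fst tendsto_snd fun _ =>
    (abs_floor_sub_le _).trans one_le_two)

/-- Continuity is inherited from the joint limit, although the approximants are discontinuous in
`x`. -/
lemma continuous_airyAi : Continuous airyAi :=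
  continuous_of_tendsto_prod (F := fun κ x => κ * besselJ ⌊2 * κ ^ 3 + x * κ⌋ (2 * κ ^ 3))
    tendsto_edge_airyAi

lemma abs_airyAi_le {c : ℝ} (hc : 0 < c) (x : ℝ) :
    |airyAi x| ≤ edgeConst c * Real.exp (-(c * x)) := by
  have hx : Tendsto (fun _ : ℝ => x) atTop (𝓝 x) := tendsto_const_nhds
  have h1 := (tendsto_edge_airyAi x).comp (tendsto_id.prodMk hx)
  have h2 := tendsto_edge_index (n := fun κ : ℝ => ⌊2 * κ ^ 3 + x * κ⌋) tendsto_id hx fun κ =>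
    (abs_floor_sub_le _).trans one_le_two
  have h3 := (((h2.const_mul c).neg).rexp).const_mul (edgeConst c)
  refine le_of_tendsto_of_tendsto h1.abs h3 ?_
  filter_upwards [eventually_ge_atTop c] with κ hκ
  exact abs_edge_besselJ_le _ hc hκ

/-! ### Domination of the thermal Airy kernel. -/

lemma integrable_exp_neg_mul_abs {b : ℝ} (hb : 0 < b) :
    Integrable fun u : ℝ => Real.exp (-(b * |u|)) := by
  rw [← integrableOn_univ, ← Set.Iic_union_Ioi (a := (0 : ℝ)), integrableOn_union]
  constructor
  · refine (integrableOn_exp_mul_Iic hb 0).congr_fun (fun u hu => ?_) measurableSet_Iic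
    simp only [abs_of_nonpos (Set.mem_Iic.mp hu), mul_neg, neg_neg]
  · refine (integrableOn_exp_mul_Ioi (neg_lt_zero.mpr hb) 0).congr_fun (fun u hu => ?_)
      measurableSet_Ioi
    simp only [abs_of_pos (Set.mem_Ioi.mp hu), neg_mul]

/-- The left side is `1/(2 cosh(a/2))`: half of the Fermi decay rate is spent, and decay on both
sides remains. -/
lemma exp_neg_half_mul_fermi_le (a : ℝ) :
    Real.exp (-(a / 2)) * (1 / (1 + Real.exp (-a))) ≤ Real.exp (-(|a| / 2)) := by
  have h1 := Real.exp_pos (-a)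
  rw [mul_one_div, div_le_iff₀ (by positivity), mul_add, mul_one, ← Real.exp_add]
  rcases le_total 0 a with ha | ha
  · rw [abs_of_nonneg ha]
    linarith [Real.exp_pos (-(a / 2) + -a)]
  · rw [abs_of_nonpos ha]
    have : -(-a / 2) + -a = -(a / 2) := by ring
    rw [this]
    linarith [Real.exp_pos (-(-a / 2))]

/-- A dominating function for the finite-temperature Airy kernel, uniform in the temperature. -/
lemma norm_airy_thermal_le {θ θ₀ : ℝ} (hθ : 0 < θ) (hθ₀ : θ ≤ θ₀) (s t u : ℝ) :
    ‖airyAi (s + u) * airyAi (t + u) / (1 + Real.exp (-u / θ))‖ ≤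
      edgeConst (1 / (4 * θ₀)) ^ 2 * Real.exp (-(1 / (4 * θ₀) * (s + t))) *
        Real.exp (-(1 / (2 * θ₀) * |u|)) := by
  have hθ₀' : 0 < θ₀ := hθ.trans_le hθ₀
  have hc : 0 < 1 / (4 * θ₀) := by positivity
  have hw : Real.exp (-(u / θ₀ / 2)) * (1 / (1 + Real.exp (-u / θ))) ≤
      Real.exp (-(|u / θ₀| / 2)) := by
    -- For `u ≥ 0` the weight is at most 1; for `u ≤ 0` it increases with `θ`, so `θ₀` is the worst
    -- case.
    rcases le_total 0 u with hu | hu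
    · rw [abs_of_nonneg (by positivity)]
      have := abs_one_div_one_add_exp_le_one (-u / θ)
      exact mul_le_of_le_one_right (Real.exp_pos _).le ((le_abs_self _).trans this)
    · refine le_trans ?_ (exp_neg_half_mul_fermi_le (u / θ₀))
      have : -(u / θ₀) ≤ -u / θ := by
        rw [← neg_div]
        exact div_le_div_of_nonneg_left (by linarith) hθ hθ₀
      gcongr
  have hpos : 0 < 1 / (1 + Real.exp (-u / θ)) := by positivity
  rw [div_eq_mul_one_div, norm_mul, norm_mul, Real.norm_eq_abs, Real.norm_eq_abs, Real.norm_eq_abs,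
    abs_of_pos hpos]
  have hE := edgeConst_nonneg (1 / (4 * θ₀))
  calc _ ≤ (edgeConst (1 / (4 * θ₀)) * Real.exp (-(1 / (4 * θ₀) * (s + u)))) *
      (edgeConst (1 / (4 * θ₀)) * Real.exp (-(1 / (4 * θ₀) * (t + u)))) *
      (1 / (1 + Real.exp (-u / θ))) := by
        gcongr
        · exact abs_airyAi_le hc _
        · exact abs_airyAi_le hc _
    _ = edgeConst (1 / (4 * θ₀)) ^ 2 * Real.exp (-(1 / (4 * θ₀) * (s + t))) *
      (Real.exp (-(u / θ₀ / 2)) * (1 / (1 + Real.exp (-u / θ)))) := by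
        have : Real.exp (-(1 / (4 * θ₀) * (s + u))) * Real.exp (-(1 / (4 * θ₀) * (t + u))) =
            Real.exp (-(1 / (4 * θ₀) * (s + t))) * Real.exp (-(u / θ₀ / 2)) := by
          rw [← Real.exp_add, ← Real.exp_add]
          congr 1
          field_simp
          ring
        linear_combination edgeConst (1 / (4 * θ₀)) ^ 2 * (1 / (1 + Real.exp (-u / θ))) * this
    _ ≤ edgeConst (1 / (4 * θ₀)) ^ 2 * Real.exp (-(1 / (4 * θ₀) * (s + t))) *
      Real.exp (-(|u / θ₀| / 2)) := by gcongr
    _ = _ := by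
        congr 3
        rw [abs_div, abs_of_pos hθ₀']
        field_simp

lemma continuous_airy_thermal (θ s t : ℝ) :
    Continuous fun u : ℝ => airyAi (s + u) * airyAi (t + u) / (1 + Real.exp (-u / θ)) := by
  have := continuous_airyAi
  refine Continuous.div (by fun_prop) (by fun_prop) fun u => ?_
  have := Real.exp_pos (-u / θ)
  positivity

lemma integrable_airy_thermal {θ : ℝ} (hθ : 0 < θ) (s t : ℝ) :
    Integrable fun u : ℝ => airyAi (s + u) * airyAi (t + u) / (1 + Real.exp (-u / θ)) :=
  ((integrable_exp_neg_mul_abs (by positivity : 0 < 1 / (2 * θ))).const_mul _).mono'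
    (continuous_airy_thermal θ s t).aestronglyMeasurable
    (Eventually.of_forall (norm_airy_thermal_le hθ le_rfl s t))

/-- On `u > 0` the weight with `θ = 1` is at least `1/2`, so twice the thermal integrand dominates.
-/
lemma integrableOn_airy (s t : ℝ) :
    IntegrableOn (fun u : ℝ => airyAi (s + u) * airyAi (t + u)) (Set.Ioi 0) := by
  have hc := continuous_airyAi
  refine Integrable.mono ((integrable_airy_thermal one_pos s t).const_mul 2).integrableOn
    (Continuous.aestronglyMeasurable (by fun_prop)) ?_
  refine (ae_restrict_mem measurableSet_Ioi).mono fun u hu => ?_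
  have h1 : Real.exp (-u / 1) ≤ 1 := Real.exp_le_one_iff.mpr (by simpa using (Set.mem_Ioi.mp hu).le)
  have h2 := Real.exp_pos (-u / 1)
  rw [mul_div_assoc', norm_div, le_div_iff₀ (norm_pos_iff.mpr (by positivity)), norm_mul (2 : ℝ), Real.norm_ofNat,
    mul_comm (2 : ℝ), Real.norm_of_nonneg (by positivity : 0 ≤ 1 + Real.exp (-u / 1))]
  gcongr
  linarith

/-! ### The zero-temperature limit. -/

lemma tendsto_fermi_step {u : ℝ} (hu : u ≠ 0) :
    Tendsto (fun θ : ℝ => (1 + Real.exp (-u / θ))⁻¹) (𝓝[>] 0)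
      (𝓝 ((Set.Ioi (0 : ℝ)).indicator 1 u)) := by
  rcases lt_or_gt_of_ne hu with h | h
  · rw [Set.indicator_of_notMem (by simpa using h.le)]
    have h1 : Tendsto (fun θ : ℝ => -u / θ) (𝓝[>] 0) atTop :=
      tendsto_inv_nhdsGT_zero.const_mul_atTop (neg_pos.mpr h)
    exact (tendsto_atTop_add_const_left _ 1 (Real.tendsto_exp_atTop.comp h1)).inv_tendsto_atTop
  · rw [Set.indicator_of_mem (Set.mem_Ioi.mpr h)]
    have h1 : Tendsto (fun θ : ℝ => -u / θ) (𝓝[>] 0) atBot :=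
      tendsto_inv_nhdsGT_zero.const_mul_atTop_of_neg (neg_lt_zero.mpr h)
    simpa using ((Real.tendsto_exp_atBot.comp h1).const_add 1).inv₀ (by norm_num)

lemma tendsto_airyKernelThermal_zero (q : ℝ × ℝ) :
    Tendsto (fun y : ℝ × ℝ × ℝ => airyKernelThermal y.1 y.2.1 y.2.2) (𝓝[>] 0 ×ˢ 𝓝 q)
      (𝓝 (airyKernel q.1 q.2)) := by
  unfold airyKernelThermal airyKernel
  have hs : Tendsto (fun y : ℝ × ℝ × ℝ => y.2.1) (𝓝[>] (0 : ℝ) ×ˢ 𝓝 q) (𝓝 q.1) :=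
    (continuous_fst.tendsto q).comp tendsto_snd
  have ht : Tendsto (fun y : ℝ × ℝ × ℝ => y.2.2) (𝓝[>] (0 : ℝ) ×ˢ 𝓝 q) (𝓝 q.2) :=
    (continuous_snd.tendsto q).comp tendsto_snd
  rw [← integral_indicator measurableSet_Ioi]
  refine tendsto_integral_filter_of_dominated_convergence
    -- `θ₀ = 1` covers all `θ ≤ 1`; the `-1` in the exponent absorbs the motion of `(s,t)` near `q`.
    (fun u : ℝ => edgeConst (1 / (4 * 1)) ^ 2 * Real.exp (-(1 / (4 * 1) * (q.1 + q.2 - 1))) *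
      Real.exp (-(1 / (2 * 1) * |u|)))
    (Eventually.of_forall fun y => (continuous_airy_thermal _ _ _).aestronglyMeasurable) ?_
    ((integrable_exp_neg_mul_abs (by norm_num)).const_mul _) ?_
  · have h1 : ∀ᶠ θ : ℝ in 𝓝[>] 0, 0 < θ ∧ θ ≤ 1 := by
      filter_upwards [Ioc_mem_nhdsGT (one_pos : (0 : ℝ) < 1)] with θ hθ using hθ
    filter_upwards [tendsto_fst.eventually h1,
      (hs.add ht).eventually (lt_mem_nhds (sub_one_lt (q.1 + q.2)))] with y hy h2
    refine Eventually.of_forall fun u => (norm_airy_thermal_le hy.1 hy.2 _ _ u).trans ?_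
    gcongr
  · have h0 : ∀ᵐ u : ℝ, u ≠ 0 := by simp [ae_iff]
    filter_upwards [h0] with u hu
    have h1 := (continuous_airyAi.tendsto _).comp (hs.add_const u)
    have h2 := (continuous_airyAi.tendsto _).comp (ht.add_const u)
    have h3 := (h1.mul h2).mul ((tendsto_fermi_step hu).comp tendsto_fst)
    have h4 : (Set.Ioi (0 : ℝ)).indicator (fun u => airyAi (q.1 + u) * airyAi (q.2 + u)) u =
        airyAi (q.1 + u) * airyAi (q.2 + u) * (Set.Ioi (0 : ℝ)).indicator 1 u := by
      by_cases h : u ∈ Set.Ioi (0 : ℝ) <;> simp [h]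
    rw [h4]
    exact h3

/-! ### The edge limit of the thermal kernel. -/

lemma integral_comp_floor {g : ℤ → ℝ} (hg : Integrable fun y : ℝ => g ⌊y⌋) :
    ∑' r : ℤ, g r = ∫ y : ℝ, g ⌊y⌋ := by
  have h := hasSum_integral_iUnion (μ := volume) (s := fun r : ℤ => Set.Ico (r : ℝ) (r + 1))
    (f := fun y : ℝ => g ⌊y⌋) (fun _ => measurableSet_Ico) (Set.pairwise_disjoint_Ico_intCast ℝ)
    hg.integrableOn
  rw [iUnion_Ico_intCast, setIntegral_univ] at h
  rw [← h.tsum_eq]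
  congr 1
  ext r
  rw [setIntegral_congr_fun (g := fun _ => g r) measurableSet_Ico
    fun y hy => by simp only [Int.floor_eq_on_Ico r y hy]]
  simp

/-- The summand of the rescaled thermal kernel, as a step function of the continuous variable. -/
noncomputable def edgeSummand (θ κ η : ℝ) (ν l r : ℤ) : ℝ :=
  (κ * besselJ (ν + r) (2 * κ ^ 3)) * (κ * besselJ (l + r) (2 * κ ^ 3)) *
    (1 / (1 + Real.exp (-((r + η) / (θ * κ)))))

lemma abs_edge_besselJ_floor_le {κ c : ℝ} (hc : 0 < c) (hcκ : c ≤ κ) (h1 : 1 ≤ κ) (s η : ℝ)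
    (hη : η ≤ 1) (r : ℤ) :
    |κ * besselJ (⌊2 * κ ^ 3 + s * κ⌋ + r) (2 * κ ^ 3)| ≤
      edgeConst c * Real.exp (-(c * (s - 2))) * Real.exp (-(c * ((r + η) / κ))) := by
  have hκ : 0 < κ := one_pos.trans_le h1
  refine (abs_edge_besselJ_le _ hc hcκ).trans ?_
  rw [mul_assoc, ← Real.exp_add]
  refine mul_le_mul_of_nonneg_left (Real.exp_le_exp.mpr ?_) (edgeConst_nonneg c)
  -- The floor and `η` cost at most 1 each, and `κ ≥ 1`, whence `s - 2`.
  have h2 : s - 2 + (r + η) / κ ≤ (((⌊2 * κ ^ 3 + s * κ⌋ + r : ℤ) : ℝ) - 2 * κ ^ 3) / κ := by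
    rw [le_div_iff₀ hκ, add_mul, div_mul_cancel₀ _ hκ.ne']
    push_cast
    nlinarith [Int.lt_floor_add_one (2 * κ ^ 3 + s * κ)]
  nlinarith [mul_le_mul_of_nonneg_left h2 hc.le]

lemma norm_edgeSummand_le {θ κ η : ℝ} (hθ : 0 < θ) (hκ : 1 / (4 * θ) ≤ κ) (h1 : 1 ≤ κ)
    (hη0 : 0 ≤ η) (hη1 : η ≤ 1) (s t u : ℝ) :
    ‖edgeSummand θ κ η ⌊2 * κ ^ 3 + s * κ⌋ ⌊2 * κ ^ 3 + t * κ⌋ ⌊κ * u⌋‖ ≤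
      edgeConst (1 / (4 * θ)) ^ 2 * Real.exp (-(1 / (4 * θ) * (s + t - 4))) *
        Real.exp (1 / (2 * θ)) * Real.exp (-(1 / (2 * θ) * |u|)) := by
  have hc : 0 < 1 / (4 * θ) := by positivity
  have hκ0 : 0 < κ := one_pos.trans_le h1
  have hE := edgeConst_nonneg (1 / (4 * θ))
  set a : ℝ := (⌊κ * u⌋ + η) / (θ * κ) with ha
  -- Two Bessel bounds with `c = 1/(4θ)` give exactly `exp(-a/2)`. Replacing `a` by `u/θ` costs at
  -- most `1/θ`, hence the factor `exp(1/(2θ))`.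
  have hau : |u| / θ ≤ |a| + 1 / θ := by
    have h2 : |u / θ - a| ≤ 1 / θ := by
      have h3 : u / θ - a = (κ * u - (⌊κ * u⌋ + η)) / (θ * κ) := by
        rw [ha]
        field_simp
      rw [h3, abs_div, abs_of_pos (by positivity : 0 < θ * κ), div_le_div_iff₀ (by positivity) hθ]
      have h4 : |κ * u - (⌊κ * u⌋ + η)| ≤ 1 := by
        rw [abs_le]
        constructor <;> linarith [Int.floor_le (κ * u), Int.lt_floor_add_one (κ * u)]
      nlinarith
    have h5 := abs_sub_abs_le_abs_sub (u / θ) a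
    rw [abs_div, abs_of_pos hθ] at h5
    linarith
  have hpos : 0 < 1 / (1 + Real.exp (-a)) := by positivity
  rw [edgeSummand, norm_mul, norm_mul, Real.norm_eq_abs, Real.norm_eq_abs, Real.norm_eq_abs,
    abs_of_pos hpos]
  calc _ ≤ (edgeConst (1 / (4 * θ)) * Real.exp (-(1 / (4 * θ) * (s - 2))) *
        Real.exp (-(1 / (4 * θ) * ((⌊κ * u⌋ + η) / κ)))) *
      (edgeConst (1 / (4 * θ)) * Real.exp (-(1 / (4 * θ) * (t - 2))) *
        Real.exp (-(1 / (4 * θ) * ((⌊κ * u⌋ + η) / κ)))) * (1 / (1 + Real.exp (-a))) := by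
        gcongr
        · exact abs_edge_besselJ_floor_le hc hκ h1 s η hη1 _
        · exact abs_edge_besselJ_floor_le hc hκ h1 t η hη1 _
    _ = edgeConst (1 / (4 * θ)) ^ 2 * Real.exp (-(1 / (4 * θ) * (s + t - 4))) *
      (Real.exp (-(a / 2)) * (1 / (1 + Real.exp (-a)))) := by
        have h2 : Real.exp (-(1 / (4 * θ) * (s - 2))) * Real.exp (-(1 / (4 * θ) * (t - 2))) =
            Real.exp (-(1 / (4 * θ) * (s + t - 4))) := by
          rw [← Real.exp_add]
          congr 1
          ring
        have h3 : Real.exp (-(1 / (4 * θ) * ((⌊κ * u⌋ + η) / κ))) *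
            Real.exp (-(1 / (4 * θ) * ((⌊κ * u⌋ + η) / κ))) = Real.exp (-(a / 2)) := by
          rw [← Real.exp_add]
          congr 1
          rw [ha]
          field_simp
          ring
        rw [← h2, ← h3]
        ring
    _ ≤ edgeConst (1 / (4 * θ)) ^ 2 * Real.exp (-(1 / (4 * θ) * (s + t - 4))) *
      (Real.exp (1 / (2 * θ)) * Real.exp (-(1 / (2 * θ) * |u|))) := by
        refine mul_le_mul_of_nonneg_left ?_ (by positivity)
        refine (exp_neg_half_mul_fermi_le a).trans ?_
        rw [← Real.exp_add, Real.exp_le_exp]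
        have h2 : 1 / (2 * θ) + -(1 / (2 * θ) * |u|) = (1 / θ - |u| / θ) / 2 := by
          field_simp
          ring
        rw [h2]
        linarith
    _ = _ := by ring

lemma aestronglyMeasurable_comp_floor_mul (g : ℤ → ℝ) (κ : ℝ) :
    AEStronglyMeasurable fun u : ℝ => g ⌊κ * u⌋ :=
  ((measurable_from_top (f := g)).comp
    (Int.measurable_floor.comp (measurable_const_mul κ))).aestronglyMeasurable

lemma fermiOffset_nonneg (hbar Ω μ E : ℝ) : 0 ≤ fermiOffset hbar Ω μ E :=
  Int.fract_nonneg _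

lemma fermiOffset_le_one (hbar Ω μ E : ℝ) : fermiOffset hbar Ω μ E ≤ 1 :=
  (Int.fract_lt_one _).le

/-- The offset `η` need not converge: it enters only through `η/κ → 0`, so the physical parameters
may vary freely with `A`. -/
lemma tendsto_integral_edgeSummand {ι : Type*} {L : Filter ι} [L.IsCountablyGenerated] {θ : ℝ}
    (hθ : 0 < θ) {κ η s t : ι → ℝ} {s₀ t₀ : ℝ} (hκ : Tendsto κ L atTop) (hη0 : ∀ i, 0 ≤ η i)
    (hη1 : ∀ i, η i ≤ 1) (hs : Tendsto s L (𝓝 s₀)) (ht : Tendsto t L (𝓝 t₀)) :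
    Tendsto (fun i => ∫ u : ℝ, edgeSummand θ (κ i) (η i) ⌊2 * κ i ^ 3 + s i * κ i⌋
      ⌊2 * κ i ^ 3 + t i * κ i⌋ ⌊κ i * u⌋) L (𝓝 (airyKernelThermal θ s₀ t₀)) := by
  have hbessel : ∀ {x : ι → ℝ} {x₀ : ℝ} (_ : Tendsto x L (𝓝 x₀)) (u : ℝ),
      Tendsto (fun i => κ i * besselJ (⌊2 * κ i ^ 3 + x i * κ i⌋ + ⌊κ i * u⌋) (2 * κ i ^ 3)) L
        (𝓝 (airyAi (x₀ + u))) := by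
    intro x x₀ hx u
    refine tendsto_edge_besselJ hκ (tendsto_edge_index hκ (hx.add_const u) fun i => ?_)
    push_cast
    have h1 := abs_add_le (⌊2 * κ i ^ 3 + x i * κ i⌋ - (2 * κ i ^ 3 + x i * κ i))
      (⌊κ i * u⌋ - κ i * u)
    have h2 := abs_floor_sub_le (2 * κ i ^ 3 + x i * κ i)
    have h3 := abs_floor_sub_le (κ i * u)
    refine le_trans (le_of_eq ?_) (h1.trans (by linarith : _ ≤ (2 : ℝ)))
    congr 1
    ring
  refine tendsto_integral_filter_of_dominated_convergence
    (fun u : ℝ => edgeConst (1 / (4 * θ)) ^ 2 *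
      Real.exp (-(1 / (4 * θ) * (s₀ + t₀ - 1 - 4))) *
        Real.exp (1 / (2 * θ)) * Real.exp (-(1 / (2 * θ) * |u|)))
    (Eventually.of_forall fun i => aestronglyMeasurable_comp_floor_mul _ _) ?_
    ((integrable_exp_neg_mul_abs (by positivity)).const_mul _) ?_
  · filter_upwards [hκ.eventually_ge_atTop 1, hκ.eventually_ge_atTop (1 / (4 * θ)),
      (hs.add ht).eventually (lt_mem_nhds (sub_one_lt (s₀ + t₀)))] with i h1 h2 h3
    refine Eventually.of_forall fun u =>
      (norm_edgeSummand_le hθ h2 h1 (hη0 i) (hη1 i) _ _ u).trans ?_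
    gcongr
  · refine Eventually.of_forall fun u => ?_
    have h1 : Tendsto (fun i => (⌊κ i * u⌋ + η i) / κ i) L (𝓝 u) := by
      have h0 : Tendsto (fun i => 1 / κ i) L (𝓝 0) := hκ.const_div_atTop 1
      have h2 : Tendsto (fun i => (⌊κ i * u⌋ + η i - κ i * u) / κ i) L (𝓝 0) := by
        refine squeeze_zero_norm' ?_ h0
        filter_upwards [hκ.eventually_gt_atTop 0] with i hi
        rw [norm_div, Real.norm_eq_abs, Real.norm_eq_abs, abs_of_pos hi]
        gcongr
        rw [abs_le]
        constructor <;>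
          linarith [Int.floor_le (κ i * u), Int.lt_floor_add_one (κ i * u), hη0 i, hη1 i]
      have h3 := h2.add_const u
      rw [zero_add] at h3
      refine h3.congr' ?_
      filter_upwards [hκ.eventually_gt_atTop 0] with i hi
      field_simp
      ring
    have h2 : Tendsto (fun i => (1 + Real.exp (-((⌊κ i * u⌋ + η i) / (θ * κ i))))⁻¹) L
        (𝓝 (1 + Real.exp (-u / θ))⁻¹) := by
      have h3 := ((h1.div_const θ).neg.rexp.const_add 1).inv₀
        (by have := Real.exp_pos (-(u / θ)); positivity)
      rw [← neg_div] at h3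
      refine h3.congr fun i => ?_
      rw [div_div, mul_comm (κ i) θ]
    simp only [edgeSummand, div_eq_mul_inv, one_mul] at h2 ⊢
    exact ((hbessel hs u).mul (hbessel ht u)).mul h2

lemma edgeScale_pos {A : ℝ} (hA : 0 < A) : 0 < edgeScale A := Real.rpow_pos_of_pos (by linarith) _

lemma two_mul_edgeScale_pow {A : ℝ} (hA : 0 < A) : 2 * edgeScale A ^ 3 = A := by
  rw [edgeScale, ← Real.rpow_natCast, ← Real.rpow_mul (by linarith)]
  norm_num
  ring

lemma tendsto_edgeScale : Tendsto edgeScale atTop atTop :=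
  (tendsto_rpow_atTop (by norm_num)).comp (tendsto_id.atTop_div_const two_pos)

lemma edgeScale_mul_thermalKernel {hbar kB Ω T A θ : ℝ} (hhbar : 0 < hbar) (hΩ : 0 < Ω)
    (hθ : 0 < θ) (hA : 0 < A) (hcross : crossoverParameter hbar kB Ω T A = θ) (μ E s t : ℝ)
    (h1 : 1 ≤ edgeScale A) (h2 : 1 / (4 * θ) ≤ edgeScale A) :
    edgeScale A * thermalKernel hbar kB Ω μ E A T (edgeIndex A s) (edgeIndex A t) =
      ∫ u : ℝ, edgeSummand θ (edgeScale A) (fermiOffset hbar Ω μ E)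
        ⌊2 * edgeScale A ^ 3 + s * edgeScale A⌋ ⌊2 * edgeScale A ^ 3 + t * edgeScale A⌋
        ⌊edgeScale A * u⌋ := by
  have hκ := edgeScale_pos hA
  have hint : Integrable fun u : ℝ => edgeSummand θ (edgeScale A) (fermiOffset hbar Ω μ E)
        ⌊2 * edgeScale A ^ 3 + s * edgeScale A⌋ ⌊2 * edgeScale A ^ 3 + t * edgeScale A⌋
        ⌊edgeScale A * u⌋ :=
    ((integrable_exp_neg_mul_abs (by positivity : 0 < 1 / (2 * θ))).const_mul _).mono'
      (aestronglyMeasurable_comp_floor_mul _ _) (Eventually.of_forall (norm_edgeSummand_le hθ h2 h1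
        (fermiOffset_nonneg _ _ _ _) (fermiOffset_le_one _ _ _ _) s t))
  have hT : kB * T = θ * edgeScale A * (hbar * Ω) := by
    rw [crossoverParameter, div_eq_iff (by positivity)] at hcross
    rw [hcross]
    ring
  -- The Jacobian `κ⁻¹` against the `κ²` in `edgeSummand` leaves the single factor `κ`.
  rw [Measure.integral_comp_mul_left (fun y : ℝ => edgeSummand θ (edgeScale A)
    (fermiOffset hbar Ω μ E) ⌊2 * edgeScale A ^ 3 + s * edgeScale A⌋
    ⌊2 * edgeScale A ^ 3 + t * edgeScale A⌋ ⌊y⌋), abs_of_pos (inv_pos.mpr hκ), smul_eq_mul,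
    ← integral_comp_floor ((integrable_comp_mul_left_iff _ hκ.ne').mp hint)]
  rw [thermalKernel, ← tsum_mul_left, ← tsum_mul_left]
  congr 1
  ext r
  have hw : (r + fermiOffset hbar Ω μ E) * (hbar * Ω) / (kB * T) =
      (r + fermiOffset hbar Ω μ E) / (θ * edgeScale A) := by
    rw [hT, mul_div_mul_right _ _ (by positivity)]
  rw [edgeSummand, hw, two_mul_edgeScale_pow hA, edgeIndex, edgeIndex]
  field_simp

lemma tendsto_edgeScale_mul_thermalKernel {hbar kB θ : ℝ} (hhbar : 0 < hbar) (hθ : 0 < θ)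
    {Ω T : ℝ → ℝ} (μ E : ℝ → ℝ) (hΩ : ∀ A, 0 < A → 0 < Ω A)
    (hcross : ∀ A, 0 < A → crossoverParameter hbar kB (Ω A) (T A) A = θ) (q : ℝ × ℝ) :
    Tendsto (fun y : ℝ × ℝ × ℝ => edgeScale y.1 * thermalKernel hbar kB (Ω y.1) (μ y.1) (E y.1) y.1
      (T y.1) (edgeIndex y.1 y.2.1) (edgeIndex y.1 y.2.2)) (atTop ×ˢ 𝓝 q)
      (𝓝 (airyKernelThermal θ q.1 q.2)) := by
  have hA : Tendsto (fun y : ℝ × ℝ × ℝ => y.1) (atTop ×ˢ 𝓝 q) atTop := tendsto_fst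
  have hκ := tendsto_edgeScale.comp hA
  have hs : Tendsto (fun y : ℝ × ℝ × ℝ => y.2.1) (atTop ×ˢ 𝓝 q) (𝓝 q.1) :=
    (continuous_fst.tendsto q).comp tendsto_snd
  have ht : Tendsto (fun y : ℝ × ℝ × ℝ => y.2.2) (atTop ×ˢ 𝓝 q) (𝓝 q.2) :=
    (continuous_snd.tendsto q).comp tendsto_snd
  refine (tendsto_integral_edgeSummand hθ hκ
    (η := fun y => fermiOffset hbar (Ω y.1) (μ y.1) (E y.1))
    (fun _ => fermiOffset_nonneg _ _ _ _) (fun _ => fermiOffset_le_one _ _ _ _) hs ht).congr' ?_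
  filter_upwards [hA.eventually_gt_atTop 0, hκ.eventually_ge_atTop 1,
    hκ.eventually_ge_atTop (1 / (4 * θ))] with y h0 h1 h2
  exact (edgeScale_mul_thermalKernel hhbar (hΩ _ h0) hθ h0 (hcross _ h0) _ _ _ _ h1 h2).symm

theorem mainTheorem5 (hbar kB : ℝ) (hhbar : 0 < hbar) (hkB : 0 < kB) :
    -- the kernel sum with the Fermi-Dirac occupation converges and gives `K_{A,T}`
    (∀ Ω μ E A T : ℝ, 0 < Ω → 0 < T → ∀ n p : ℤ,
      HasSum
        (fun m : ℤ => besselJ (n - m) A * besselJ (p - m) A *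
          fermiDirac kB T μ (E + m * (hbar * Ω)))
        (thermalKernel hbar kB Ω μ E A T
          (n - fermiCutoff hbar Ω μ E) (p - fermiCutoff hbar Ω μ E))) ∧
    -- the limiting kernels are given by absolutely convergent integrals
    (∀ θ : ℝ, 0 < θ → ∀ s t : ℝ,
      Integrable (fun u : ℝ => airyAi (s + u) * airyAi (t + u) / (1 + Real.exp (-u / θ)))) ∧
    (∀ s t : ℝ, IntegrableOn (fun u : ℝ => airyAi (s + u) * airyAi (t + u)) (Set.Ioi 0)) ∧
    -- the edge limit `A → ∞` with `θ_A = θ` held fixed; the physical parameters may vary with `A`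
    (∀ θ : ℝ, 0 < θ → ∀ Ω T μ E : ℝ → ℝ,
      (∀ A : ℝ, 0 < A → 0 < Ω A) →
      (∀ A : ℝ, 0 < A → crossoverParameter hbar kB (Ω A) (T A) A = θ) →
      TendstoLocallyUniformly
        (fun (A : ℝ) (q : ℝ × ℝ) => edgeScale A *
          thermalKernel hbar kB (Ω A) (μ A) (E A) A (T A) (edgeIndex A q.1) (edgeIndex A q.2))
        (fun q : ℝ × ℝ => airyKernelThermal θ q.1 q.2)
        atTop) ∧
    -- the zero-temperature limit of the limiting kernel
    TendstoLocallyUniformly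
      (fun (θ : ℝ) (q : ℝ × ℝ) => airyKernelThermal θ q.1 q.2)
      (fun q : ℝ × ℝ => airyKernel q.1 q.2)
      (𝓝[>] (0 : ℝ)) := by

  refine ⟨fun Ω μ E A T hΩ _ n p => hasSum_fermiDirac hhbar.ne' hΩ.ne' μ E A n p,
    fun θ hθ s t => integrable_airy_thermal hθ s t, integrableOn_airy, ?_, ?_⟩
  · intro θ hθ Ω T μ E hΩ hcross
    exact tendstoLocallyUniformly_of_tendsto_prod
      (tendsto_edgeScale_mul_thermalKernel hhbar hθ μ E hΩ hcross)
  · exact tendstoLocallyUniformly_of_tendsto_prod tendsto_airyKernelThermal_zero
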